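/- Let $\mathcal H$ be a complex Hilbert space of finite dimension $d\ge 2$. A POVM on $\mathcal H$ is a finite family of positive operators with sum $I$. A SIC on $\mathcal H$ is a POVM $\mathsf G=(\mathsf G(i))_{i\in\Omega}$ with $|\Omega|=d^2$ such that $$\operatorname{tr}[\mathsf G(k)\mathsf G(\ell)]=\frac1{d^2(d+1)}\quad(k\ne\ell),\qquad \operatorname{tr}[\mathsf G(k)^2]=\frac1{d^2}.$$ A partition $\mathcal P$ of $\Omega$ into nonempty disjoint bins defines a marginal $\mathsf E^{\mathcal P}$ of $\mathsf G$, the POVM whose outcomes are the bins $B\in\mathcal P$ and whose operators are $\mathsf E^{\mathcal P}(B)=\sum_{i\in B}\mathsf G(i)$. A set $\{\mathsf E^j\}_{j\in J}$ of POVMs is called mutually unbiased if each $\mathsf E^j$ has exactly $d$ outcomes and $\operatorname{tr}[\mathsf E^j(a)\mathsf E^k(b)]=1/d$ for all $j\ne k$ and all outcomes $a$ of $\mathsf E^j$, $b$ of $\mathsf E^k$. Let $\mathsf G$ be any SIC on $\mathcal H$. Then: 1. There is a set of at least three marginals of $\mathsf G$, given by distinct partitions of $\Omega$, that are mutually unbiased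 POVMs. 2. Every set of mutually unbiased marginals of $\mathsf G$ has at most $d+1$ members. 3. If $d=6$, every set of mutually unbiased marginals of $\mathsf G$ has at most three members. In 2 and 3 the marginals need not be assumed to have $d$ outcomes: the trace relations $\operatorname{tr}[\mathsf E^j(a)\mathsf E^k(b)]=1/d$ for $j\neq k$ suffice. -/

import Mathlib

open Module

/-- A positive operator valued measure with finite outcome set `Ω` on a finite-dimensional complex
Hilbert space: a family of positive operators that sums to the identity. -/
def IsPOVM {H : Type*} [NormedAddCommGroup H] [InnerProductSpace ℂ H] [FiniteDimensional ℂ H]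
    {Ω : Type*} [Fintype Ω] (E : Ω → H →ₗ[ℂ] H) : Prop :=
  (∀ k, (E k).IsPositive) ∧ ∑ k, E k = LinearMap.id

/-- A symmetric informationally complete POVM on a Hilbert space of dimension `d = finrank ℂ H`. -/
structure IsSIC {H : Type*} [NormedAddCommGroup H] [InnerProductSpace ℂ H] [FiniteDimensional ℂ H]
    {Ω : Type*} [Fintype Ω] (G : Ω → H →ₗ[ℂ] H) : Prop where
  isPOVM : IsPOVM G
  card_outcomes : Fintype.card Ω = finrank ℂ H ^ 2
  trace_mul : ∀ k l, k ≠ l →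
    LinearMap.trace ℂ H (G k ∘ₗ G l) = 1 / ((finrank ℂ H : ℂ) ^ 2 * (1 + (finrank ℂ H : ℂ)))
  trace_sq : ∀ k, LinearMap.trace ℂ H (G k ∘ₗ G k) = 1 / (finrank ℂ H : ℂ) ^ 2

/-- The marginal of `G` given by a partition `P` of its outcome set into (nonempty, disjoint) bins:
its outcomes are the bins, and the operator of a bin is the sum of the operators of `G` in it. -/
def marginal {H : Type*} [NormedAddCommGroup H] [InnerProductSpace ℂ H]
    {Ω : Type*} [Fintype Ω] [DecidableEq Ω] (G : Ω → H →ₗ[ℂ] H)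
    (P : Finpartition (Finset.univ : Finset Ω)) : P.parts → H →ₗ[ℂ] H :=
  fun B => ∑ i ∈ B.1, G i

/-- The unbiasedness relations `tr (E j a * E k b) = 1 / d` between different members of a family
of operator-valued functions, with no condition on the number of outcomes. -/
def Unbiased {H : Type*} [NormedAddCommGroup H] [InnerProductSpace ℂ H]
    {J : Type*} {I : J → Type*} (E : ∀ j, I j → H →ₗ[ℂ] H) : Prop :=
  ∀ j k, j ≠ k → ∀ (a : I j) (b : I k),
    LinearMap.trace ℂ H (E j a ∘ₗ E k b) = 1 / (finrank ℂ H : ℂ)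

/-- Mutually unbiased POVMs: a family of POVMs with `d = finrank ℂ H` outcomes each, satisfying the
unbiasedness relations. -/
structure MutuallyUnbiased {H : Type*} [NormedAddCommGroup H] [InnerProductSpace ℂ H]
    [FiniteDimensional ℂ H] {J : Type*} {I : J → Type*} [∀ j, Fintype (I j)]
    (E : ∀ j, I j → H →ₗ[ℂ] H) : Prop where
  isPOVM : ∀ j, IsPOVM (E j)
  card_outcomes : ∀ j, Fintype.card (I j) = finrank ℂ H
  unbiased : Unbiased E

/-! By bilinearity of the trace, unbiasedness of two marginals says |B||C| + d|B ∩ C| = d(d + 1) for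
all bins B of P and C of Q. Summing over C gives |B| = |Q|, hence |P||Q| = d² and |B ∩ C| = 1. Three
such partitions must have d bins each, so the family is a net of order d, equivalently a set of
mutually orthogonal Latin squares. Claim 1 is then the net x, y, x + y on (ℤ/d)², claim 2 the bound
`IsNet.card_le`, and claim 3 Tarry's theorem `not_isNet_of_card_eq_six`.

For Tarry's theorem, read f i ω = a as: block ω contains point a of group i. With four groups of six
points the incidence matrix modulo two has rank at most 20, so there are sets A i, not all empty or
full, whose union every block meets evenly. When their total size is least, counting forces |A i| =
2, each block meeting the union in zero or two points (`IsNet.exists_pairs`). The blocks joining A 0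
to A 1 and A 2 to A 3 then name the points outside the pairs; this fixes eight blocks, and the
finite search `not_extendable` finds no completion. -/

/-! ### Finite search for orthogonal Latin squares -/

/-- Two quadruples agree everywhere or in at most one coordinate. -/
def agreeAtMostOnce (t u : ℕ × ℕ × ℕ × ℕ) : Bool :=
  bif t.1 == u.1 then
    bif t.2.1 == u.2.1 then t.2.2.1 == u.2.2.1 && t.2.2.2 == u.2.2.2
    else !(t.2.2.1 == u.2.2.1) && !(t.2.2.2 == u.2.2.2)
  else
    bif t.2.1 == u.2.1 then !(t.2.2.1 == u.2.2.1) && !(t.2.2.2 == u.2.2.2)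
    else !(t.2.2.1 == u.2.2.1 && t.2.2.2 == u.2.2.2)

/-- Exactly none or two of the coordinates of a quadruple are smaller than `2`. -/
def hasZeroOrTwoSmall (t : ℕ × ℕ × ℕ × ℕ) : Bool :=
  let n := (bif Nat.blt t.1 2 then 1 else 0) + (bif Nat.blt t.2.1 2 then 1 else 0) +
    (bif Nat.blt t.2.2.1 2 then 1 else 0) + (bif Nat.blt t.2.2.2 2 then 1 else 0)
  n == 0 || n == 2

/-- The admissible quadruples over `{0, …, 5}` with the given first two coordinates. -/
def quadruplesAt (c : ℕ × ℕ) : List (ℕ × ℕ × ℕ × ℕ) :=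
  ([0, 1, 2, 3, 4, 5].flatMap fun l => [0, 1, 2, 3, 4, 5].map fun m => (c.1, c.2, l, m)).filter
    hasZeroOrTwoSmall

/-- Backtracking search for pairwise compatible quadruples at the given cells, all of them
compatible with the quadruples in `S`. -/
def extendable : List (ℕ × ℕ) → List (ℕ × ℕ × ℕ × ℕ) → Bool
  | [], _ => true
  | c :: cs, S => (quadruplesAt c).any fun t => S.all (agreeAtMostOnce t) && extendable cs (t :: S)

/-- Soundness of the search: at each cell the quadruple from T is a valid choice, so a failed search
refutes T. -/
theorem extendable_of_subset {T : Set (ℕ × ℕ × ℕ × ℕ)}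
    (hT : ∀ t ∈ T, ∀ u ∈ T, agreeAtMostOnce t u = true) (cs : List (ℕ × ℕ))
    (hcs : ∀ c ∈ cs, ∃ t ∈ T, t ∈ quadruplesAt c) (S : List (ℕ × ℕ × ℕ × ℕ))
    (hS : ∀ s ∈ S, s ∈ T) : extendable cs S = true := by
  induction cs generalizing S with
  | nil => rfl
  | cons c cs ih =>
    obtain ⟨t, htT, ht⟩ := hcs c (by simp)
    simp only [extendable, List.any_eq_true, Bool.and_eq_true, List.all_eq_true]
    refine ⟨t, ht, fun s hs => hT t htT s (hS s hs), ih (fun c hc => hcs c (by simp [hc])) _ ?_⟩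
    simpa [htT] using hS

/-- The off-diagonal cells, in an order that keeps the search tree small. -/
def searchCells : List (ℕ × ℕ) :=
  [(0, 2), (1, 2), (0, 3), (0, 4), (0, 5), (1, 5), (1, 3), (1, 4), (2, 0), (2, 1), (3, 0), (3, 1),
    (4, 0), (4, 1), (5, 0), (5, 1), (3, 2), (4, 2), (5, 2), (3, 5), (3, 4), (5, 4), (5, 3)]

/-- The quadruples that a pair of orthogonal Latin squares of order six may be assumed to have. -/
def initialQuadruples : List (ℕ × ℕ × ℕ × ℕ) :=
  [(0, 0, 2, 2), (0, 1, 3, 3), (1, 0, 4, 4), (1, 1, 5, 5),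
    (2, 2, 0, 0), (3, 3, 0, 1), (4, 4, 1, 0), (5, 5, 1, 1)]

theorem not_extendable : extendable searchCells initialQuadruples = false := by
  decide +kernel

/-! ### Nets and their incidence rank modulo two -/

/-- Sylvester's rank inequality. -/
theorem Matrix.rank_add_rank_le_card_add_rank_mul {K l m n : Type*} [Field K] [Fintype l]
    [Fintype m] [Fintype n] (A : Matrix l m K) (B : Matrix m n K) :
    A.rank + B.rank ≤ Fintype.card m + (A * B).rank := by
  classical
  set W := LinearMap.range B.mulVecLin
  set g := A.mulVecLin.domRestrict W
  have hA := A.mulVecLin.finrank_range_add_finrank_ker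
  have hg := g.finrank_range_add_finrank_ker
  have hrange : LinearMap.range g = LinearMap.range (A * B).mulVecLin := by
    rw [Matrix.mulVecLin_mul, LinearMap.range_comp, LinearMap.range_domRestrict]
  have hker : finrank K (LinearMap.ker g) ≤ finrank K (LinearMap.ker A.mulVecLin) := by
    rw [LinearEquiv.finrank_eq (Submodule.equivMapOfInjective W.subtype
      W.injective_subtype (LinearMap.ker g))]
    refine Submodule.finrank_mono ?_
    rintro _ ⟨x, hx, rfl⟩
    exact hx
  rw [hrange] at hg
  simp only [finrank_fintype_fun_eq_card] at hA
  unfold Matrix.rank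
  change _ + finrank K W ≤ _
  omega

/-- A family of functions any two of which are jointly a bijection: the classes of the net given by
the fibers of these functions. -/
def IsNet {ι Ω X : Type*} (f : ι → Ω → X) : Prop :=
  ∀ i j, i ≠ j → Function.Bijective fun ω => (f i ω, f j ω)

namespace IsNet

variable {ι Ω X : Type*} {f : ι → Ω → X}

theorem eq_of_eq (h : IsNet f) {i j : ι} (hij : i ≠ j) {ω η : Ω} (hi : f i ω = f i η)
    (hj : f j ω = f j η) : ω = η :=
  (h i j hij).1 (Prod.ext hi hj)

theorem exists_eq (h : IsNet f) {i j : ι} (hij : i ≠ j) (a b : X) : ∃ ω, f i ω = a ∧ f j ω = b := by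
  obtain ⟨ω, hω⟩ := (h i j hij).2 (a, b)
  exact ⟨ω, (Prod.ext_iff.1 hω).1, (Prod.ext_iff.1 hω).2⟩

theorem comp_equiv {Y : Type*} (h : IsNet f) (e : ι → X ≃ Y) : IsNet fun i ω => e i (f i ω) := by
  intro i j hij
  exact ((e i).prodCongr (e j)).bijective.comp (h i j hij)

theorem card_fiber_filter [Fintype Ω] [DecidableEq X] (h : IsNet f) {i j : ι} (hij : i ≠ j)
    (a : X) (B : Finset X) :
    (Finset.univ.filter fun ω => f i ω = a ∧ f j ω ∈ B).card = B.card := by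
  refine Finset.card_bij (fun ω _ => f j ω) (by simp) ?_ ?_
  · intro ω hω η hη hj
    simp only [Finset.mem_filter, Finset.mem_univ, true_and] at hω hη
    exact h.eq_of_eq hij (hω.1.trans hη.1.symm) hj
  · intro b hb
    obtain ⟨ω, h1, h2⟩ := h.exists_eq hij a b
    exact ⟨ω, by simp [h1, h2, hb], h2⟩

theorem card_fiber [Fintype Ω] [Fintype X] [DecidableEq X] (h : IsNet f) {i j : ι} (hij : i ≠ j)
    (a : X) : (Finset.univ.filter fun ω => f i ω = a).card = Fintype.card X := by
  rw [← Finset.card_univ, ← h.card_fiber_filter hij a Finset.univ]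
  simp

/-- Double counting of the incidences of the blocks through a point with sets of points in the
other groups. -/
theorem sum_fiber_card [Fintype Ω] [Fintype ι] [DecidableEq ι] [DecidableEq X] (h : IsNet f)
    (A : ι → Finset X) (i : ι) (a : X) :
    ∑ ω with f i ω = a, ((Finset.univ.erase i).filter fun j => f j ω ∈ A j).card =
      ∑ j ∈ Finset.univ.erase i, (A j).card := by
  simp_rw [Finset.card_filter]
  rw [Finset.sum_comm]
  refine Finset.sum_congr rfl fun j hj => ?_
  rw [← h.card_fiber_filter (Finset.ne_of_mem_erase hj).symm a (A j), ← Finset.card_filter,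
    Finset.filter_filter]

end IsNet

/-- The incidence matrix modulo two of points and blocks of a net. -/
def incidenceModTwo {ι Ω X : Type*} [DecidableEq X] (f : ι → Ω → X) :
    Matrix (ι × X) Ω (ZMod 2) :=
  fun p ω => if f p.1 ω = p.2 then 1 else 0

/-- Points of different groups share exactly one block, distinct points of one group share none, and
a point lies on |X| blocks, an even number. -/
theorem IsNet.incidenceModTwo_mul_transpose {ι Ω X : Type*} [DecidableEq ι] [Fintype Ω] [Fintype X]
    [DecidableEq X] {f : ι → Ω → X} (h : IsNet f) (hX : Even (Fintype.card X)) {i₀ j₀ : ι}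
    (hij : i₀ ≠ j₀) (p q : ι × X) :
    (incidenceModTwo f * (incidenceModTwo f).transpose) p q = if p.1 = q.1 then 0 else 1 := by
  simp only [Matrix.mul_apply, Matrix.transpose_apply, incidenceModTwo, ← ite_and, mul_ite, mul_one,
    mul_zero]
  rw [← Finset.sum_filter, Finset.sum_const, nsmul_eq_mul, mul_one]
  split_ifs with hpq
  · obtain ⟨p, a⟩ := p
    obtain ⟨q, b⟩ := q
    obtain rfl : p = q := hpq
    by_cases hab : a = b
    · subst hab
      obtain ⟨j, hj⟩ : ∃ j, p ≠ j := by
        by_cases hp : p = i₀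
        · exact ⟨j₀, hp ▸ hij⟩
        · exact ⟨i₀, hp⟩
      simp only [and_self]
      rw [h.card_fiber hj a, ZMod.natCast_eq_zero_iff_even]
      exact hX
    · rw [Finset.filter_false_of_mem, Finset.card_empty, Nat.cast_zero]
      rintro ω - ⟨h1, h2⟩
      exact hab (h2.symm.trans h1)
  · have := h.card_fiber_filter (Ne.symm hpq) q.2 {p.2}
    simp only [Finset.mem_singleton, Finset.card_singleton] at this
    rw [this, Nat.cast_one]

/-- The product with the transpose depends only on the groups, so it factors through four
coordinates. With 36 blocks, Sylvester's inequality gives 2r ≤ 36 + 4. -/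
theorem IsNet.rank_incidenceModTwo_le {Ω X : Type*} [Fintype Ω] [Fintype X]
    [DecidableEq X] {f : Fin 4 → Ω → X} (h : IsNet f) (hX : Fintype.card X = 6) :
    (incidenceModTwo f).rank ≤ 20 := by
  have hΩ : Fintype.card Ω = 36 := by
    rw [Fintype.card_of_bijective (h 0 1 (by decide)), Fintype.card_prod, hX]
  have hs := Matrix.rank_add_rank_le_card_add_rank_mul (incidenceModTwo f)
    (incidenceModTwo f).transpose
  have hK : (incidenceModTwo f * (incidenceModTwo f).transpose).rank ≤ 4 := by
    have : incidenceModTwo f * (incidenceModTwo f).transpose =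
        (Matrix.of fun (p : Fin 4 × X) (k : Fin 4) => if p.1 = k then (0 : ZMod 2) else 1) *
          (Matrix.of fun (k : Fin 4) (q : Fin 4 × X) => if k = q.1 then (1 : ZMod 2) else 0) := by
      ext p q
      rw [h.incidenceModTwo_mul_transpose (hX ▸ by decide) (show (0 : Fin 4) ≠ 1 by decide)]
      simp [Matrix.mul_apply]
    rw [this]
    exact (Matrix.rank_mul_le_left _ _).trans ((Matrix.rank_le_card_width _).trans (by simp))
  rw [Matrix.rank_transpose, hΩ] at hs
  omega

/-- A nontrivial linear dependency modulo two between the points of a net. -/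
theorem IsNet.exists_even_sets {Ω X : Type*} [Fintype Ω] [Fintype X]
    [DecidableEq X] {f : Fin 4 → Ω → X} (h : IsNet f) (hX : Fintype.card X = 6) :
    ∃ A : Fin 4 → Finset X, (∀ ω, Even (Finset.univ.filter fun i => f i ω ∈ A i).card) ∧
      ∃ i, (A i).Nonempty ∧ A i ≠ Finset.univ := by
  have : Nonempty X := Fintype.card_pos_iff.1 (by omega)
  have hrk := h.rank_incidenceModTwo_le hX
  rw [← Matrix.rank_transpose] at hrk
  set L := (incidenceModTwo f).transpose.mulVecLin
  have hdim := L.finrank_range_add_finrank_ker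
  rw [finrank_fintype_fun_eq_card, Fintype.card_prod, hX, Fintype.card_fin] at hdim
  have hL : ∀ v ω, L v ω = ∑ i, v (i, f i ω) := by
    intro v ω
    simp [L, Matrix.vecMul, dotProduct, incidenceModTwo, Fintype.sum_prod_type]
  -- The range of `c` consists of the functions constant on each group. Its dimension is at most 4,
  -- while the kernel of `L` has dimension at least 24 - 20 = 4. The indicator of group 0 is not in
  -- the kernel, so the kernel is not contained in this range.
  let c : (Fin 4 → ZMod 2) →ₗ[ZMod 2] (Fin 4 × X → ZMod 2) := LinearMap.funLeft _ _ Prod.fst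
  obtain ⟨v, hv, hvc⟩ : ∃ v ∈ LinearMap.ker L, v ∉ LinearMap.range c := by
    by_contra! hle
    have hc : finrank (ZMod 2) (LinearMap.range c) ≤ 4 := by
      simpa using c.finrank_range_le
    have hlt : LinearMap.ker L < LinearMap.range c := by
      refine lt_of_le_of_ne hle fun heq => ?_
      have hm : c (Pi.single 0 1) ∈ LinearMap.ker L := heq ▸ LinearMap.mem_range_self _ _
      obtain ⟨ω, -⟩ := h.exists_eq (show (0 : Fin 4) ≠ 1 by decide) (Classical.arbitrary X)
        (Classical.arbitrary X)
      have := congrFun (LinearMap.mem_ker.1 hm) ω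
      rw [hL] at this
      simp [c, LinearMap.funLeft_apply] at this
    have := Submodule.finrank_lt_finrank_of_lt hlt
    change finrank (ZMod 2) (LinearMap.range L) ≤ 20 at hrk
    omega
  refine ⟨fun i => Finset.univ.filter fun a => v (i, a) = 1, fun ω => ?_, ?_⟩
  · have := congrFun (LinearMap.mem_ker.1 hv) ω
    rw [hL] at this
    rw [← ZMod.natCast_eq_zero_iff_even, Finset.card_filter, Nat.cast_sum]
    simp only [Pi.zero_apply] at this
    rw [← this]
    refine Finset.sum_congr rfl fun i _ => ?_
    simp only [Finset.mem_filter, Finset.mem_univ, true_and]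
    generalize v (i, f i ω) = x
    revert x
    decide
  · by_contra! hcon
    refine hvc ⟨fun i => v (i, Classical.arbitrary X), ?_⟩
    ext ⟨i, a⟩
    simp only [c, LinearMap.funLeft_apply]
    have key : ∀ x y : ZMod 2, (x = 1 ↔ y = 1) → x = y := by decide
    apply key
    by_cases he : (Finset.univ.filter fun a => v (i, a) = 1) = ∅
    · simp only [Finset.filter_eq_empty_iff, Finset.mem_univ, true_imp_iff] at he
      simp [he]
    · have := hcon i (Finset.nonempty_iff_ne_empty.2 he)
      simp only [Finset.filter_eq_self, Finset.mem_univ, true_imp_iff] at this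
      simp [this]

/-! ### From a parity dependency to four pairs of points -/

/-- Here s i stands for |A i| and t i for the total size of the other three sets. The t i add up to
three times the sum of all s i, so that sum and every s i are even; the halves lie in {0, …, 3} and
are checked exhaustively. -/
theorem eq_two_or_exists (s t : Fin 4 → ℕ) (hst : ∀ i, s i + t i = s 0 + s 1 + s 2 + s 3)
    (ht : ∀ i, Even (t i)) (hs : ∀ i, 0 < s i → 6 ≤ t i) (hle : ∀ i j, i ≠ j → s i + s j ≤ 6)
    (h0 : ∃ i, 0 < s i ∧ s i < 6) :
    (∀ i, s i = 2) ∨ ∃ i j, t i = 6 ∧ 6 < t j ∧ 0 < s j := by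
  have key : ∀ x₀ x₁ x₂ x₃ : Fin 4, ∀ x : Fin 4 → Fin 4, x = ![x₀, x₁, x₂, x₃] →
      (∀ i, 0 < (x i).val → 3 + (x i).val ≤ x₀.val + x₁ + x₂ + x₃) →
      (∀ i j, i ≠ j → (x i).val + (x j).val ≤ 3) → (∃ i, 0 < (x i).val ∧ (x i).val < 3) →
      (∀ i, (x i).val = 1) ∨ ∃ i j, x₀.val + x₁ + x₂ + x₃ = 3 + (x i).val ∧
        3 + (x j).val < x₀.val + x₁ + x₂ + x₃ ∧ 0 < (x j).val := by
    intro x₀ x₁ x₂ x₃ x hx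
    subst hx
    revert x₀ x₁ x₂ x₃
    decide +kernel
  have heven : ∀ i, s i % 2 = 0 := by
    have h0' := hst 0
    have h1' := hst 1
    have h2' := hst 2
    have h3' := hst 3
    have e := fun i => Nat.even_iff.1 (ht i)
    have e0 := e 0
    have e1 := e 1
    have e2 := e 2
    have e3 := e 3
    clear hs hle h0 hst ht key e
    intro i
    have : (s 0 + s 1 + s 2 + s 3) % 2 = 0 := by omega
    fin_cases i <;> dsimp <;> omega
  have hlt : ∀ i, s i < 8 := fun i => by
    obtain ⟨j, hj⟩ := exists_ne i
    have := hle i j hj.symm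
    omega
  choose x hx using fun i => show ∃ x : Fin 4, s i = 2 * x.val from
    ⟨⟨s i / 2, by have := hlt i; omega⟩, by have := heven i; dsimp; omega⟩
  have hxe : x = ![x 0, x 1, x 2, x 3] := by
    ext i
    fin_cases i <;> rfl
  have hst' : ∀ i, t i + 2 * (x i).val = 2 * ((x 0).val + x 1 + x 2 + x 3) := fun i => by
    have := hst i
    simp only [hx] at this
    omega
  have hs' : ∀ i, 0 < (x i).val → 3 + (x i).val ≤ (x 0).val + x 1 + x 2 + x 3 := fun i hi => by
    have := hs i (by rw [hx]; omega)
    have := hst' i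
    omega
  have hle' : ∀ i j, i ≠ j → (x i).val + (x j).val ≤ 3 := fun i j hij => by
    have := hle i j hij
    rw [hx, hx] at this
    omega
  have h0' : ∃ i, 0 < (x i).val ∧ (x i).val < 3 := by
    obtain ⟨i, h1, h2⟩ := h0
    rw [hx] at h1 h2
    exact ⟨i, by omega, by omega⟩
  rcases key _ _ _ _ x hxe hs' hle' h0' with h | ⟨i, j, h1, h2, h3⟩
  · exact Or.inl fun i => by rw [hx, h]
  · have hi := hst' i
    have hj := hst' j
    have hxj := hx j
    exact Or.inr ⟨i, j, by omega, by omega, by omega⟩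

section EvenSets

variable {Ω X : Type*} [DecidableEq X] {f : Fin 4 → Ω → X} {A : Fin 4 → Finset X}

theorem card_filter_eq_card_filter_erase_add (f : Fin 4 → Ω → X) (A : Fin 4 → Finset X) (i : Fin 4)
    (ω : Ω) : (Finset.univ.filter fun j => f j ω ∈ A j).card =
      ((Finset.univ.erase i).filter fun j => f j ω ∈ A j).card + if f i ω ∈ A i then 1 else 0 := by
  simp only [Finset.card_filter]
  exact (Finset.sum_erase_add _ _ (Finset.mem_univ i)).symm

theorem odd_card_filter_erase
    (hA : ∀ ω, Even (Finset.univ.filter fun i => f i ω ∈ A i).card) {i : Fin 4} {ω : Ω}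
    (hi : f i ω ∈ A i) : Odd ((Finset.univ.erase i).filter fun j => f j ω ∈ A j).card := by
  have := hA ω
  rw [card_filter_eq_card_filter_erase_add f A i ω, if_pos hi] at this
  simpa [Nat.even_add_one] using this

/-- Complementing the sets of two groups keeps all intersections with blocks even. -/
theorem even_card_filter_compl [Fintype X]
    (hA : ∀ ω, Even (Finset.univ.filter fun i => f i ω ∈ A i).card)
    {i j : Fin 4} (hij : i ≠ j) (ω : Ω) :
    Even (Finset.univ.filter fun k =>
      f k ω ∈ if k = i ∨ k = j then (A k)ᶜ else A k).card := by
  have hω := hA ω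
  rw [← ZMod.natCast_eq_zero_iff_even, Finset.card_filter, Nat.cast_sum] at hω ⊢
  -- Complementing adds 1 to an indicator modulo two, and this happens for exactly two groups.
  have hpair : ∑ k : Fin 4, (if k = i ∨ k = j then (1 : ZMod 2) else 0) = 0 := by
    revert i j
    decide
  have hω' := congrArg₂ (· + ·) hω hpair
  simp only [add_zero, ← Finset.sum_add_distrib] at hω'
  rw [← hω']
  refine Finset.sum_congr rfl fun k _ => ?_
  by_cases h1 : k = i ∨ k = j <;> by_cases h2 : f k ω ∈ A k <;>
    simp [h1, h2, CharTwo.add_self_eq_zero]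

variable [Fintype Ω] [Fintype X]

/-- Add up the even intersections over the six blocks through one point of group i. That group
itself contributes 0 or 6. -/
theorem IsNet.even_sum_card (h : IsNet f) (hX : Fintype.card X = 6)
    (hA : ∀ ω, Even (Finset.univ.filter fun i => f i ω ∈ A i).card) (i : Fin 4) :
    Even (∑ j ∈ Finset.univ.erase i, (A j).card) := by
  have : Nonempty X := Fintype.card_pos_iff.1 (by omega)
  obtain ⟨j, hj⟩ := exists_ne i
  set a := Classical.arbitrary X
  have key : Even (∑ ω with f i ω = a, (Finset.univ.filter fun j => f j ω ∈ A j).card) :=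
    Finset.even_sum _ fun ω _ => hA ω
  simp_rw [card_filter_eq_card_filter_erase_add f A i] at key
  rw [Finset.sum_add_distrib, h.sum_fiber_card A i a, Nat.even_add] at key
  refine key.2 ?_
  rw [Finset.sum_congr rfl (g := fun _ => if a ∈ A i then 1 else 0)
    (fun ω hω => by rw [(Finset.mem_filter.1 hω).2]), Finset.sum_const, h.card_fiber hj.symm a, hX,
    smul_eq_mul]
  exact (by decide : Even 6).mul_right _

/-- Each of the six blocks through a point of A i meets the other sets an odd number of times, hence
at least once. -/
theorem IsNet.six_le_sum_card (h : IsNet f) (hX : Fintype.card X = 6)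
    (hA : ∀ ω, Even (Finset.univ.filter fun i => f i ω ∈ A i).card) {i : Fin 4}
    (hi : (A i).Nonempty) : 6 ≤ ∑ j ∈ Finset.univ.erase i, (A j).card := by
  obtain ⟨a, ha⟩ := hi
  obtain ⟨j, hj⟩ := exists_ne i
  rw [← h.sum_fiber_card A i a, ← hX, ← h.card_fiber hj.symm a, Finset.card_eq_sum_ones]
  refine Finset.sum_le_sum fun ω hω => (odd_card_filter_erase hA ?_).pos
  rwa [(Finset.mem_filter.1 hω).2]

/-- Equality case of the previous bound: six positive terms with sum six. -/
theorem IsNet.card_filter_erase_eq_one (h : IsNet f) (hX : Fintype.card X = 6)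
    (hA : ∀ ω, Even (Finset.univ.filter fun i => f i ω ∈ A i).card) {i : Fin 4}
    (hi : ∑ j ∈ Finset.univ.erase i, (A j).card = 6) {ω : Ω} (hω : f i ω ∈ A i) :
    ((Finset.univ.erase i).filter fun j => f j ω ∈ A j).card = 1 := by
  obtain ⟨j, hj⟩ := exists_ne i
  rw [← h.sum_fiber_card A i (f i ω), ← hX, ← h.card_fiber hj.symm (f i ω),
    Finset.card_eq_sum_ones] at hi
  refine ((Finset.sum_eq_sum_iff_of_le fun η hη => ?_).1 hi.symm ω (by simp)).symm
  refine (odd_card_filter_erase hA ?_).pos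
  rwa [(Finset.mem_filter.1 hη).2]

/-- Six odd numbers with sum above six include one exceeding 1; with only three other groups it is
3. -/
theorem IsNet.exists_forall_mem (h : IsNet f) (hX : Fintype.card X = 6)
    (hA : ∀ ω, Even (Finset.univ.filter fun i => f i ω ∈ A i).card) {i : Fin 4}
    (hi : 6 < ∑ j ∈ Finset.univ.erase i, (A j).card) (hne : (A i).Nonempty) :
    ∃ ω, ∀ j, f j ω ∈ A j := by
  obtain ⟨a, ha⟩ := hne
  obtain ⟨j, hj⟩ := exists_ne i
  rw [← h.sum_fiber_card A i a, ← hX, ← h.card_fiber hj.symm a, Finset.card_eq_sum_ones] at hi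
  obtain ⟨ω, hω, hlt⟩ := Finset.exists_lt_of_sum_lt hi
  have hωi : f i ω ∈ A i := by rwa [(Finset.mem_filter.1 hω).2]
  refine ⟨ω, fun k => ?_⟩
  obtain ⟨m, hm⟩ := odd_card_filter_erase hA hωi
  by_cases hk : k = i
  · exact hk ▸ hωi
  have hcard : (Finset.univ.erase i : Finset (Fin 4)).card = 3 := by simp
  have hall := Finset.eq_of_subset_of_card_le
    (Finset.filter_subset (fun j => f j ω ∈ A j) (Finset.univ.erase i)) (by omega)
  have hmem : k ∈ Finset.univ.erase i := by simp [hk]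
  rw [← hall] at hmem
  exact (Finset.mem_filter.1 hmem).2

/-- Two points in each group of four mutually orthogonal parallel classes of order six, such that
each block contains none or exactly two of them. -/
theorem IsNet.exists_pairs (h : IsNet f) (hX : Fintype.card X = 6) :
    ∃ A : Fin 4 → Finset X, (∀ i, (A i).card = 2) ∧ ∀ ω i, f i ω ∈ A i →
      ((Finset.univ.erase i).filter fun j => f j ω ∈ A j).card = 1 := by
  classical
  let good : (Fin 4 → Finset X) → Prop := fun A =>
    (∀ ω, Even (Finset.univ.filter fun i => f i ω ∈ A i).card) ∧
      ∃ i, (A i).Nonempty ∧ A i ≠ Finset.univ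
  obtain ⟨A₀, hA₀⟩ : ∃ A, good A := h.exists_even_sets hX
  obtain ⟨A, hAg, hmin⟩ := Finset.exists_min_image (Finset.univ.filter good)
    (fun A => ∑ i, (A i).card) ⟨A₀, by simp [hA₀]⟩
  obtain ⟨hA, i₀, hi₀, hi₀'⟩ := (Finset.mem_filter.1 hAg).2
  -- Complementing A i and A j turns their joint size s into 12 - s and keeps the family good, so
  -- minimality gives s ≤ 6.
  have hle : ∀ i j, i ≠ j → (A i).card + (A j).card ≤ 6 := by
    intro i j hij
    have := hmin (fun k => if k = i ∨ k = j then (A k)ᶜ else A k) (by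
      refine Finset.mem_filter.2 ⟨Finset.mem_univ _, even_card_filter_compl hA hij, i₀, ?_⟩
      dsimp only
      split_ifs with hc
      · exact ⟨Finset.nonempty_iff_ne_empty.2 (by simpa using hi₀'),
          by simpa using hi₀.ne_empty⟩
      · exact ⟨hi₀, hi₀'⟩)
    have hcard : ∀ k, (A k).card + (A k)ᶜ.card = 6 := fun k => by
      rw [Finset.card_add_card_compl, hX]
    have h0 := hcard 0
    have h1 := hcard 1
    have h2 := hcard 2
    have h3 := hcard 3
    simp only [Fin.sum_univ_four] at this
    clear hmin hA hA₀
    fin_cases i <;> fin_cases j <;> simp at this hij ⊢ <;> omega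
  have heven := h.even_sum_card hX hA
  have hsix := fun i => h.six_le_sum_card hX hA (i := i)
  have hone := fun i (hi : ∑ j ∈ Finset.univ.erase i, (A j).card = 6) (ω : Ω) =>
    h.card_filter_erase_eq_one hX hA hi (ω := ω)
  have hsum : ∀ i, (A i).card + ∑ j ∈ Finset.univ.erase i, (A j).card =
      (A 0).card + (A 1).card + (A 2).card + (A 3).card := by
    intro i
    rw [Finset.add_sum_erase _ (fun j => (A j).card) (Finset.mem_univ i), Fin.sum_univ_four]
  have hall := fun i (hi : 6 < ∑ j ∈ Finset.univ.erase i, (A j).card) =>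
    h.exists_forall_mem hX hA hi
  have hlt : (A i₀).card < 6 := hX ▸ (Finset.card_lt_iff_ne_univ _).2 hi₀'
  refine ⟨A, ?_⟩
  rcases eq_two_or_exists (fun i => (A i).card)
    (fun i => ∑ j ∈ Finset.univ.erase i, (A j).card) hsum heven
    (fun i hi => hsix i (Finset.card_pos.1 hi)) hle ⟨i₀, hi₀.card_pos, hlt⟩ with h2 | ⟨i, j, hi, hj, hj'⟩
  · refine ⟨h2, fun ω i hω => hone i ?_ ω hω⟩
    have := hsum i
    simp only [h2] at this ⊢
    omega
  -- A block meeting all four sets contradicts that a block through A i meets just one of the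
  -- others.
  · obtain ⟨ω, hω⟩ := hall j hj (Finset.card_pos.1 hj')
    have := hone i hi ω (hω i)
    rw [Finset.filter_true_of_mem fun k _ => hω k] at this
    simp at this

end EvenSets

/-! ### Normal form and Tarry's theorem -/

section Pairs

variable {Ω X : Type*} [DecidableEq X] {f : Fin 4 → Ω → X} {A : Fin 4 → Finset X}

theorem exists_ne_mem_of_card_eq_one {ω : Ω} {i : Fin 4}
    (h1 : ((Finset.univ.erase i).filter fun j => f j ω ∈ A j).card = 1) :
    ∃ j, j ≠ i ∧ f j ω ∈ A j := by
  obtain ⟨j, hj⟩ := Finset.card_pos.1 (h1 ▸ Nat.one_pos)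
  simp only [Finset.mem_filter, Finset.mem_erase, Finset.mem_univ, and_true] at hj
  exact ⟨j, hj⟩

theorem eq_of_mem_of_card_eq_one {ω : Ω} {i j k : Fin 4}
    (h1 : ((Finset.univ.erase i).filter fun j => f j ω ∈ A j).card = 1) (hij : j ≠ i) (hik : k ≠ i)
    (hj : f j ω ∈ A j) (hk : f k ω ∈ A k) : j = k :=
  Finset.card_le_one.1 h1.le j (by simp [hij, hj]) k (by simp [hik, hk])

/-- The blocks meeting two given pairs meet the other groups in distinct points. -/
theorem IsNet.eq_of_mem_pairs (h : IsNet f) (hA : ∀ i, (A i).card = 2)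
    (h1 : ∀ ω i, f i ω ∈ A i → ((Finset.univ.erase i).filter fun j => f j ω ∈ A j).card = 1)
    {i j k l : Fin 4} (hik : i ≠ k) (hjk : j ≠ k) (hij : i ≠ j) (hkl : k ≠ l) (hil : i ≠ l)
    (hjl : j ≠ l) {ω η : Ω} (hω : f i ω ∈ A i ∧ f j ω ∈ A j) (hη : f i η ∈ A i ∧ f j η ∈ A j)
    (hk : f k ω = f k η) : ω = η := by
  have hcover : ∀ m, m = i ∨ m = j ∨ m = k ∨ m = l := by
    clear hω hη hk
    revert i j k l
    decide +kernel
  by_contra hne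
  have hkω : f k ω ∉ A k := fun hmem =>
    hjk (eq_of_mem_of_card_eq_one (h1 ω i hω.1) hij.symm hik.symm hω.2 hmem)
  -- Distinct blocks through a common point of group k differ in every other group, so `ω` and `η`
  -- exhaust both pairs A i and A j.
  have hpair : ∀ m, m ≠ k → f m ω ∈ A m → f m η ∈ A m → ∀ x ∈ A m, x = f m ω ∨ x = f m η := by
    intro m hm h2 h3 x hx
    have hneq : f m ω ≠ f m η := fun he => hne (h.eq_of_eq hm he hk)
    have hsub : ({f m ω, f m η} : Finset X) = A m :=
      Finset.eq_of_subset_of_card_le (by simp [Finset.insert_subset_iff, h2, h3])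
        (by rw [hA, Finset.card_pair hneq])
    simpa [← hsub] using hx
  obtain ⟨a, ha⟩ := Finset.card_pos.1 (by rw [hA l]; decide : 0 < (A l).card)
  -- The block `θ` joins the common point to A l. It must meet A i or A j, hence shares a second
  -- point with `ω` or `η` and equals it; but that block would then meet three pairs.
  obtain ⟨θ, hθk, hθl⟩ := h.exists_eq hkl (f k ω) a
  obtain ⟨m, hml, hm⟩ := exists_ne_mem_of_card_eq_one (h1 θ l (hθl ▸ ha))
  have hmk : m ≠ k := by
    rintro rfl
    exact hkω (hθk ▸ hm)
  have hmij : m = i ∨ m = j := by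
    rcases hcover m with h' | h' | h' | h'
    · exact Or.inl h'
    · exact Or.inr h'
    · exact absurd h' hmk
    · exact absurd h' hml
  have hmω : f m ω ∈ A m ∧ f m η ∈ A m := by
    rcases hmij with rfl | rfl
    · exact ⟨hω.1, hη.1⟩
    · exact ⟨hω.2, hη.2⟩
  have hθ : θ = ω ∨ θ = η := (hpair m hmk hmω.1 hmω.2 _ hm).imp
    (fun he => h.eq_of_eq hmk he hθk) (fun he => h.eq_of_eq hmk he (hθk.trans hk))
  rcases hθ with rfl | rfl
  · exact hjl (eq_of_mem_of_card_eq_one (h1 θ i hω.1) hij.symm hil.symm hω.2 (hθl ▸ ha))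
  · exact hjl (eq_of_mem_of_card_eq_one (h1 θ i hη.1) hij.symm hil.symm hη.2 (hθl ▸ ha))

end Pairs

/-- This numbers a group: the distinguished pair gets 0 and 1, and the points on four suitable
blocks get 2 to 5. -/
theorem injective_vecCons_six {X : Type*} {A : Finset X} {p : Fin 2 → X} {q : Fin 2 → Fin 2 → X}
    (hp : Function.Injective p) (hpA : ∀ a, p a ∈ A) (hqA : ∀ a b, q a b ∉ A)
    (hq : ∀ a b a' b', q a b = q a' b' → a = a' ∧ b = b') :
    Function.Injective ![p 0, p 1, q 0 0, q 0 1, q 1 0, q 1 1] := by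
  have hpq : ∀ a b c, p a ≠ q b c := fun a b c he => hqA b c (he ▸ hpA a)
  have hqp : ∀ a b c, q b c ≠ p a := fun a b c he => hpq a b c he.symm
  have hqq : ∀ a b a' b', q a b = q a' b' ↔ a = a' ∧ b = b' := fun a b a' b' =>
    ⟨hq a b a' b', fun he => by rw [he.1, he.2]⟩
  intro x y hxy
  fin_cases x <;> fin_cases y <;> simp [hpq, hqp, hqq, hp.eq_iff] at hxy ⊢

/-- A normal form for a net with distinguished pairs of points that each block meets in none or
two points. -/
theorem false_of_normal_form {Ω : Type*} {g : Fin 4 → Ω → Fin 6} (h : IsNet g)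
    (hpair : ∀ ω i, (g i ω).val < 2 → ∃ j, j ≠ i ∧ (g j ω).val < 2)
    (htriple : ∀ ω i j k, j ≠ i → k ≠ i → j ≠ k → (g i ω).val < 2 → (g j ω).val < 2 →
      ¬ (g k ω).val < 2)
    (hinit : ∀ s ∈ initialQuadruples, ∃ ω,
      s = ((g 0 ω).val, (g 1 ω).val, (g 2 ω).val, (g 3 ω).val)) : False := by
  let T : Set (ℕ × ℕ × ℕ × ℕ) :=
    Set.range fun ω => ((g 0 ω).val, (g 1 ω).val, (g 2 ω).val, (g 3 ω).val)
  have hT : ∀ t ∈ T, ∀ u ∈ T, agreeAtMostOnce t u = true := by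
    rintro _ ⟨ω, rfl⟩ _ ⟨η, rfl⟩
    by_cases hωη : ω = η
    · subst hωη
      simp [agreeAtMostOnce]
    · have hne : ∀ i j, i ≠ j → (g i ω).val = (g i η).val → (g j ω).val ≠ (g j η).val :=
        fun i j hij hi hj => hωη (h.eq_of_eq hij (Fin.ext hi) (Fin.ext hj))
      have h01 := hne 0 1 (by decide)
      have h02 := hne 0 2 (by decide)
      have h03 := hne 0 3 (by decide)
      have h12 := hne 1 2 (by decide)
      have h13 := hne 1 3 (by decide)
      have h23 := hne 2 3 (by decide)
      by_cases e0 : (g 0 ω).val = (g 0 η).val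
      · simp [agreeAtMostOnce, e0, h01 e0, h02 e0, h03 e0]
      · by_cases e1 : (g 1 ω).val = (g 1 η).val
        · simp [agreeAtMostOnce, e0, e1, h12 e1, h13 e1]
        · simpa [agreeAtMostOnce, e0, e1, imp_iff_not_or] using h23
  have hsmall : ∀ ω, hasZeroOrTwoSmall
      ((g 0 ω).val, (g 1 ω).val, (g 2 ω).val, (g 3 ω).val) = true := by
    intro ω
    have h2 := hpair ω
    have h012 := htriple ω 0 1 2 (by decide) (by decide) (by decide)
    have h013 := htriple ω 0 1 3 (by decide) (by decide) (by decide)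
    have h023 := htriple ω 0 2 3 (by decide) (by decide) (by decide)
    have h123 := htriple ω 1 2 3 (by decide) (by decide) (by decide)
    simp [Fin.forall_fin_succ, Fin.exists_fin_succ] at h2
    simp only [← Nat.blt_eq] at h012 h013 h023 h123
    simp only [hasZeroOrTwoSmall]
    simp only [← Nat.lt_succ_iff, ← Nat.blt_eq] at h2
    -- Only the smallness of each coordinate matters, which leaves sixteen Boolean cases.
    generalize Nat.blt (g 0 ω).val 2 = b₀ at *
    generalize Nat.blt (g 1 ω).val 2 = b₁ at *
    generalize Nat.blt (g 2 ω).val 2 = b₂ at *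
    generalize Nat.blt (g 3 ω).val 2 = b₃ at *
    clear hpair htriple hinit hT
    cases b₀ <;> cases b₁ <;> cases b₂ <;> cases b₃ <;> simp_all
  have := extendable_of_subset hT searchCells (fun c hc => ?_) initialQuadruples
    (fun s hs => (hinit s hs).imp fun _ hω => hω.symm)
  · rw [not_extendable] at this
    exact Bool.false_ne_true this
  · have hlt : c.1 < 6 ∧ c.2 < 6 := by
      revert c
      decide
    obtain ⟨ω, h0, h1⟩ := h.exists_eq (show (0 : Fin 4) ≠ 1 by decide) ⟨c.1, hlt.1⟩ ⟨c.2, hlt.2⟩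
    refine ⟨_, ⟨ω, rfl⟩, List.mem_filter.2 ⟨?_, hsmall ω⟩⟩
    have hmem : ∀ x : Fin 6, x.val ∈ [0, 1, 2, 3, 4, 5] := by decide
    exact List.mem_flatMap.2 ⟨_, hmem (g 2 ω), List.mem_map.2 ⟨_, hmem (g 3 ω), by simp only [h0, h1]⟩⟩

/-- There are no four mutually orthogonal parallel classes of order six: Tarry's theorem that there
are no orthogonal Latin squares of order six. -/
theorem not_isNet_of_card_eq_six {Ω X : Type*} [Fintype Ω] [Fintype X] (hX : Fintype.card X = 6)
    (f : Fin 4 → Ω → X) : ¬ IsNet f := by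
  classical
  intro h
  obtain ⟨A, hA, h1⟩ := h.exists_pairs hX
  have hp : ∀ i, ∃ p : Fin 2 → X, Function.Injective p ∧ ∀ x, x ∈ A i ↔ ∃ a, x = p a := by
    intro i
    obtain ⟨x, y, hxy, he⟩ := Finset.card_eq_two.1 (hA i)
    refine ⟨![x, y], ?_, ?_⟩
    · intro a b hab
      fin_cases a <;> fin_cases b <;> simp [hxy, hxy.symm] at hab ⊢
    · simp [he]
  choose p hpinj hpA using hp
  have hpm : ∀ i a, p i a ∈ A i := fun i a => (hpA i _).2 ⟨a, rfl⟩
  -- The blocks `u a b` join A 0 to A 1, and the blocks `v a b` join A 2 to A 3.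
  choose u hu0 hu1 using fun a b => h.exists_eq (show (0 : Fin 4) ≠ 1 by decide) (p 0 a) (p 1 b)
  choose v hv2 hv3 using fun a b => h.exists_eq (show (2 : Fin 4) ≠ 3 by decide) (p 2 a) (p 3 b)
  have hinj : ∀ {i j k l : Fin 4} (w : Fin 2 → Fin 2 → Ω), i ≠ k → j ≠ k → i ≠ j → k ≠ l → i ≠ l →
      j ≠ l → (∀ a b, f i (w a b) = p i a) → (∀ a b, f j (w a b) = p j b) → Function.Injective
        ![p k 0, p k 1, f k (w 0 0), f k (w 0 1), f k (w 1 0), f k (w 1 1)] := by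
    intro i j k l w hik hjk hij hkl hil hjl hi hj
    refine injective_vecCons_six (q := fun a b => f k (w a b)) (hpinj k) (hpm k) ?_ ?_
    · intro a b hmem
      exact hjk (eq_of_mem_of_card_eq_one (h1 (w a b) i (hi a b ▸ hpm i a)) hij.symm hik.symm
        (hj a b ▸ hpm j b) hmem)
    · intro a b a' b' he
      have := h.eq_of_mem_pairs hA h1 hik hjk hij hkl hil hjl
        ⟨hi a b ▸ hpm i a, hj a b ▸ hpm j b⟩ ⟨hi a' b' ▸ hpm i a', hj a' b' ▸ hpm j b'⟩ he
      exact ⟨hpinj i (by rw [← hi a b, ← hi a' b', this]),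
        hpinj j (by rw [← hj a b, ← hj a' b', this])⟩
  -- Groups 0 and 1 are numbered through the blocks `v`, groups 2 and 3 through `u`, so that these
  -- eight blocks become `initialQuadruples`.
  have he : ∀ k, ∃ e : Fin 6 ≃ X, (e 0 = p k 0 ∧ e 1 = p k 1) ∧
      (∀ w, w = (if k = 0 ∨ k = 1 then v else u) →
        e 2 = f k (w 0 0) ∧ e 3 = f k (w 0 1) ∧ e 4 = f k (w 1 0) ∧ e 5 = f k (w 1 1)) := by
    intro k
    suffices hs : Function.Injective (![p k 0, p k 1, f k ((if k = 0 ∨ k = 1 then v else u) 0 0),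
        f k ((if k = 0 ∨ k = 1 then v else u) 0 1), f k ((if k = 0 ∨ k = 1 then v else u) 1 0),
        f k ((if k = 0 ∨ k = 1 then v else u) 1 1)]) by
      refine ⟨Equiv.ofBijective _ ((Fintype.bijective_iff_injective_and_card _).2
        ⟨hs, by rw [hX, Fintype.card_fin]⟩), ⟨rfl, rfl⟩, ?_⟩
      rintro w rfl
      exact ⟨rfl, rfl, rfl, rfl⟩
    fin_cases k
    · exact hinj (l := 1) v (i := 2) (j := 3) (by decide) (by decide) (by decide) (by decide)
        (by decide) (by decide) hv2 hv3
    · exact hinj (l := 0) v (i := 2) (j := 3) (by decide) (by decide) (by decide) (by decide)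
        (by decide) (by decide) hv2 hv3
    · exact hinj (l := 3) u (i := 0) (j := 1) (by decide) (by decide) (by decide) (by decide)
        (by decide) (by decide) hu0 hu1
    · exact hinj (l := 2) u (i := 0) (j := 1) (by decide) (by decide) (by decide) (by decide)
        (by decide) (by decide) hu0 hu1
  choose e hep hew using he
  have hlt : ∀ i ω, ((e i).symm (f i ω)).val < 2 ↔ f i ω ∈ A i := by
    intro i ω
    obtain ⟨x, hx⟩ := (e i).surjective (f i ω)
    rw [← hx, Equiv.symm_apply_apply, hpA]
    simp only [Fin.exists_fin_two, ← (hep i).1, ← (hep i).2, (e i).injective.eq_iff]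
    revert x
    simp only [Fin.forall_fin_succ]
    simp
  refine false_of_normal_form (g := fun i ω => (e i).symm (f i ω))
    (h.comp_equiv fun i => (e i).symm) ?_ ?_ ?_
  · intro ω i hi
    simp only [hlt] at hi ⊢
    exact exists_ne_mem_of_card_eq_one (h1 ω i hi)
  · intro ω i j k hji hki hjk hi hj hk
    simp only [hlt] at hi hj hk
    exact hjk (eq_of_mem_of_card_eq_one (h1 ω i hi) hji hki hj hk)
  · have hsymm : ∀ i ω x, e i x = f i ω → ((e i).symm (f i ω)).val = x.val := by
      intro i ω x hx
      rw [← hx, Equiv.symm_apply_apply]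
    obtain ⟨a2, a3, a4, a5⟩ := hew 0 v rfl
    obtain ⟨b2, b3, b4, b5⟩ := hew 1 v rfl
    obtain ⟨c2, c3, c4, c5⟩ := hew 2 u rfl
    obtain ⟨d2, d3, d4, d5⟩ := hew 3 u rfl
    have hU : ∀ a b x y z w, e 0 x = p 0 a → e 1 y = p 1 b → e 2 z = f 2 (u a b) →
        e 3 w = f 3 (u a b) → ∃ ω, (x.val, y.val, z.val, w.val) = (((e 0).symm (f 0 ω)).val,
          ((e 1).symm (f 1 ω)).val, ((e 2).symm (f 2 ω)).val, ((e 3).symm (f 3 ω)).val) := by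
      intro a b x y z w hx hy hz hw
      refine ⟨u a b, ?_⟩
      rw [hsymm 0 _ x (hx.trans (hu0 a b).symm), hsymm 1 _ y (hy.trans (hu1 a b).symm),
        hsymm 2 _ z hz, hsymm 3 _ w hw]
    have hV : ∀ a b x y z w, e 0 x = f 0 (v a b) → e 1 y = f 1 (v a b) → e 2 z = p 2 a →
        e 3 w = p 3 b → ∃ ω, (x.val, y.val, z.val, w.val) = (((e 0).symm (f 0 ω)).val,
          ((e 1).symm (f 1 ω)).val, ((e 2).symm (f 2 ω)).val, ((e 3).symm (f 3 ω)).val) := by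
      intro a b x y z w hx hy hz hw
      refine ⟨v a b, ?_⟩
      rw [hsymm 0 _ x hx, hsymm 1 _ y hy, hsymm 2 _ z (hz.trans (hv2 a b).symm),
        hsymm 3 _ w (hw.trans (hv3 a b).symm)]
    simp only [initialQuadruples, List.forall_mem_cons]
    exact ⟨hU 0 0 0 0 2 2 (hep 0).1 (hep 1).1 c2 d2, hU 0 1 0 1 3 3 (hep 0).1 (hep 1).2 c3 d3,
      hU 1 0 1 0 4 4 (hep 0).2 (hep 1).1 c4 d4, hU 1 1 1 1 5 5 (hep 0).2 (hep 1).2 c5 d5,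
      hV 0 0 2 2 0 0 a2 b2 (hep 2).1 (hep 3).1, hV 0 1 3 3 0 1 a3 b3 (hep 2).1 (hep 3).2,
      hV 1 0 4 4 1 0 a4 b4 (hep 2).2 (hep 3).1, hV 1 1 5 5 1 1 a5 b5 (hep 2).2 (hep 3).2, by simp⟩

/-! ### Nets with few and with many classes -/

/-- A net of order `n` has at most `n + 1` classes. -/
theorem IsNet.card_le {ι Ω X : Type*} [Fintype ι] [Nontrivial ι] [Fintype Ω] [Fintype X]
    {f : ι → Ω → X} (h : IsNet f) (hX : 2 ≤ Fintype.card X) :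
    Fintype.card ι ≤ Fintype.card X + 1 := by
  classical
  obtain ⟨i₀, j₀, hij⟩ := exists_pair_ne ι
  have : Nonempty X := Fintype.card_pos_iff.1 (by omega)
  obtain ⟨ω₀, -⟩ := h.exists_eq hij (Classical.arbitrary X) (Classical.arbitrary X)
  -- The other blocks sharing with `ω₀` its point in group i: n - 1 for each i, disjoint for
  -- different i, among n² - 1 blocks in all.
  let s : ι → Finset Ω := fun i => (Finset.univ.filter fun ω => f i ω = f i ω₀).erase ω₀
  have hs : ∀ i, (s i).card = Fintype.card X - 1 := by
    intro i
    obtain ⟨j, hj⟩ := exists_ne i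
    rw [Finset.card_erase_of_mem (by simp), h.card_fiber hj.symm]
  have hdisj : ∀ i ∈ Finset.univ, ∀ j ∈ Finset.univ, i ≠ j → Disjoint (s i) (s j) := by
    intro i _ j _ hij
    refine Finset.disjoint_left.2 fun ω hi hj => ?_
    simp only [s, Finset.mem_erase, Finset.mem_filter, Finset.mem_univ, true_and] at hi hj
    exact hi.1 (h.eq_of_eq hij hi.2 hj.2)
  have hle : (Finset.univ.biUnion s).card ≤ (Finset.univ.erase ω₀).card :=
    Finset.card_le_card (Finset.biUnion_subset.2 fun i _ =>
      Finset.erase_subset_erase _ (Finset.filter_subset _ _))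
  rw [Finset.card_biUnion hdisj, Finset.sum_congr rfl fun i _ => hs i, Finset.sum_const,
    Finset.card_univ, Finset.card_erase_of_mem (Finset.mem_univ _), Finset.card_univ,
    Fintype.card_of_bijective (h i₀ j₀ hij), Fintype.card_prod, smul_eq_mul] at hle
  obtain ⟨n, hn⟩ : ∃ n, Fintype.card X = n + 2 := ⟨_, (Nat.sub_add_cancel hX).symm⟩
  rw [hn] at hle ⊢
  have h1 : (n + 2) * (n + 2) - 1 = (n + 3) * (n + 1) := by
    rw [Nat.sub_eq_iff_eq_add (by nlinarith)]
    ring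
  rw [h1, show n + 2 - 1 = n + 1 from rfl] at hle
  exact Nat.le_of_mul_le_mul_right hle n.succ_pos

/-- Projections and sum form a net with three classes. -/
theorem isNet_fst_snd_add (X : Type*) [AddCommGroup X] :
    IsNet ![Prod.fst, Prod.snd, fun x : X × X => x.1 + x.2] := by
  have h01 : Function.Bijective fun x : X × X => (x.1, x.2) := Function.bijective_id
  have h02 : Function.Bijective fun x : X × X => (x.1, x.1 + x.2) :=
    Function.bijective_iff_has_inverse.2 ⟨fun y => (y.1, y.2 - y.1),
      fun x => by simp, fun x => by simp⟩
  have h12 : Function.Bijective fun x : X × X => (x.2, x.1 + x.2) :=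
    Function.bijective_iff_has_inverse.2 ⟨fun y => (y.2 - y.1, y.1),
      fun x => by simp, fun x => by simp⟩
  have hs : ∀ {g : X × X → X × X}, Function.Bijective g → Function.Bijective fun x => (g x).swap :=
    fun hg => (Equiv.prodComm X X).bijective.comp hg
  intro i j hij
  fin_cases i <;> fin_cases j
  · exact absurd rfl hij
  · exact h01
  · exact h02
  · exact hs h01
  · exact absurd rfl hij
  · exact h12
  · exact hs h02
  · exact hs h12
  · exact absurd rfl hij

theorem IsNet.comp_bijective {ι Ω Ω' X : Type*} {f : ι → Ω → X} (h : IsNet f) {g : Ω' → Ω}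
    (hg : Function.Bijective g) : IsNet fun i => f i ∘ g :=
  fun i j hij => (h i j hij).comp hg

/-! ### From counting relations on partitions to nets -/

section Partitions

variable {Ω : Type*} [Fintype Ω] [DecidableEq Ω]

/-- The cardinality form of the unbiasedness relations between two marginals of a SIC in dimension
`d`. -/
def OrthogonalPartitions (d : ℕ) (P Q : Finpartition (Finset.univ : Finset Ω)) : Prop :=
  ∀ B ∈ P.parts, ∀ C ∈ Q.parts, B.card * C.card + d * (B ∩ C).card = d * (d + 1)

theorem OrthogonalPartitions.symm {d : ℕ} {P Q : Finpartition (Finset.univ : Finset Ω)}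
    (h : OrthogonalPartitions d P Q) : OrthogonalPartitions d Q P := by
  intro C hC B hB
  rw [mul_comm, Finset.inter_comm]
  exact h B hB C hC

theorem Finpartition.sum_card_inter_parts (Q : Finpartition (Finset.univ : Finset Ω))
    (B : Finset Ω) : ∑ C ∈ Q.parts, (B ∩ C).card = B.card := by
  rw [Finset.card_eq_sum_card_fiberwise (f := Q.part) (t := Q.parts)
    fun b _ => Q.part_mem.2 (Finset.mem_univ b)]
  refine Finset.sum_congr rfl fun C hC => ?_
  congr 1
  ext b
  simp [Q.part_eq_iff_mem hC]

/-- Summing the relation over all C in Q gives |B|d² + d|B| = |Q|d(d + 1). -/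
theorem OrthogonalPartitions.card_eq {d : ℕ} (hd : 0 < d) (hΩ : Fintype.card Ω = d ^ 2)
    {P Q : Finpartition (Finset.univ : Finset Ω)} (h : OrthogonalPartitions d P Q)
    {B : Finset Ω} (hB : B ∈ P.parts) : B.card = Q.parts.card := by
  have hsum := Finset.sum_congr rfl fun C hC => h B hB C hC
  rw [Finset.sum_add_distrib, ← Finset.mul_sum, ← Finset.mul_sum, Q.sum_card_inter_parts,
    Q.sum_card_parts, Finset.card_univ, hΩ, Finset.sum_const, smul_eq_mul] at hsum
  refine Nat.eq_of_mul_eq_mul_right (show 0 < d * (d + 1) by positivity) ?_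
  linarith

theorem OrthogonalPartitions.card_mul_card {d : ℕ} (hd : 0 < d) (hΩ : Fintype.card Ω = d ^ 2)
    {P Q : Finpartition (Finset.univ : Finset Ω)} (h : OrthogonalPartitions d P Q) :
    P.parts.card * Q.parts.card = d ^ 2 := by
  rw [← hΩ, ← Finset.card_univ, ← P.sum_card_parts,
    Finset.sum_congr rfl fun B hB => h.card_eq hd hΩ hB, Finset.sum_const, smul_eq_mul]

/-- Here |B||C| = |Q||P| = d², which leaves d|B ∩ C| = d. -/
theorem OrthogonalPartitions.card_inter {d : ℕ} (hd : 0 < d) (hΩ : Fintype.card Ω = d ^ 2)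
    {P Q : Finpartition (Finset.univ : Finset Ω)} (h : OrthogonalPartitions d P Q)
    {B C : Finset Ω} (hB : B ∈ P.parts) (hC : C ∈ Q.parts) : (B ∩ C).card = 1 := by
  have hBC := h B hB C hC
  rw [h.card_eq hd hΩ hB, h.symm.card_eq hd hΩ hC, mul_comm, h.card_mul_card hd hΩ] at hBC
  refine Nat.eq_of_mul_eq_mul_left hd ?_
  linarith

/-- The three pairwise products of the bin numbers all equal d². Two partitions would not suffice:
the one-bin partition is orthogonal to the partition into singletons. -/
theorem OrthogonalPartitions.card_parts {d : ℕ} (hd : 0 < d) (hΩ : Fintype.card Ω = d ^ 2)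
    {P Q R : Finpartition (Finset.univ : Finset Ω)} (hPQ : OrthogonalPartitions d P Q)
    (hPR : OrthogonalPartitions d P R) (hQR : OrthogonalPartitions d Q R) : P.parts.card = d := by
  have h1 := hPQ.card_mul_card hd hΩ
  have h2 := hPR.card_mul_card hd hΩ
  have h3 := hQR.card_mul_card hd hΩ
  have hQ : 0 < Q.parts.card := Nat.pos_of_ne_zero fun h0 => by
    rw [h0, mul_zero] at h1
    exact absurd h1.symm (by positivity)
  have hR : 0 < R.parts.card := Nat.pos_of_ne_zero fun h0 => by
    rw [h0, mul_zero] at h2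
    exact absurd h2.symm (by positivity)
  have h4 : P.parts.card = Q.parts.card := Nat.eq_of_mul_eq_mul_right hR (h2.trans h3.symm)
  rw [← h4, ← sq] at h1
  exact Nat.pow_left_injective two_ne_zero h1

/-- Pairwise orthogonal partitions into `d` bins are the classes of a net. -/
theorem exists_isNet_of_orthogonalPartitions {ι : Type*} {d : ℕ} (hd : 0 < d)
    (hΩ : Fintype.card Ω = d ^ 2) (P : ι → Finpartition (Finset.univ : Finset Ω))
    (hP : ∀ i, (P i).parts.card = d)
    (h : ∀ i j, i ≠ j → OrthogonalPartitions d (P i) (P j)) :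
    ∃ f : ι → Ω → Fin d, IsNet f := by
  let e : ∀ i, (P i).parts ≃ Fin d := fun i => Fintype.equivFinOfCardEq (by simp [hP])
  refine ⟨fun i ω => e i ⟨(P i).part ω, (P i).part_mem.2 (Finset.mem_univ ω)⟩, fun i j hij =>
    (Fintype.bijective_iff_injective_and_card _).2 ⟨fun ω η he => ?_, by simp [hΩ, sq]⟩⟩
  simp only [Prod.mk.injEq, (e _).injective.eq_iff, Subtype.mk.injEq] at he
  have hcard := (h i j hij).card_inter hd hΩ ((P i).part_mem.2 (Finset.mem_univ ω))
    ((P j).part_mem.2 (Finset.mem_univ ω))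
  refine Finset.card_le_one.1 hcard.le ω (by simp) η ?_
  rw [he.1, he.2]
  simp

/-- The partition into the fibers of a function. -/
def fiberPartition {X : Type*} [DecidableEq X] (f : Ω → X) :
    Finpartition (Finset.univ : Finset Ω) :=
  letI : DecidableRel (Setoid.ker f).r := fun a b => inferInstanceAs (Decidable (f a = f b))
  Finpartition.ofSetoid (Setoid.ker f)

theorem exists_of_mem_fiberPartition {X : Type*} [DecidableEq X] {f : Ω → X} {B : Finset Ω}
    (hB : B ∈ (fiberPartition f).parts) : ∃ x, B = Finset.univ.filter fun ω => f ω = x := by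
  obtain ⟨a, ha⟩ := (fiberPartition f).nonempty_of_mem_parts hB
  refine ⟨f a, ?_⟩
  rw [← (fiberPartition f).part_eq_of_mem hB ha]
  ext ω
  rw [fiberPartition, Finpartition.mem_part_ofSetoid_iff_rel]
  simp [eq_comm]

theorem IsNet.orthogonalPartitions {ι X : Type*} [Fintype X] [DecidableEq X] {f : ι → Ω → X}
    (h : IsNet f) {i j : ι} (hij : i ≠ j) :
    OrthogonalPartitions (Fintype.card X) (fiberPartition (f i)) (fiberPartition (f j)) := by
  intro B hB C hC
  obtain ⟨x, rfl⟩ := exists_of_mem_fiberPartition hB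
  obtain ⟨y, rfl⟩ := exists_of_mem_fiberPartition hC
  rw [h.card_fiber hij, h.card_fiber hij.symm, ← Finset.filter_and]
  have := h.card_fiber_filter hij x {y}
  simp only [Finset.mem_singleton, Finset.card_singleton] at this
  rw [this]
  ring

end Partitions

/-! ### Marginals of a SIC -/

section SIC

variable {H : Type*} [NormedAddCommGroup H] [InnerProductSpace ℂ H] [FiniteDimensional ℂ H]
  {Ω : Type*} [Fintype Ω] [DecidableEq Ω] {G : Ω → H →ₗ[ℂ] H}

theorem IsPOVM.marginal (hG : IsPOVM G) (P : Finpartition (Finset.univ : Finset Ω)) :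
    IsPOVM (marginal G P) := by
  refine ⟨fun B => LinearMap.isPositive_sum _ fun i _ => hG.1 i, ?_⟩
  rw [← hG.2]
  simp only [_root_.marginal]
  rw [Finset.sum_coe_sort P.parts fun B => ∑ i ∈ B, G i]
  conv_rhs => rw [← P.biUnion_parts, Finset.sum_biUnion P.disjoint]
  rfl

/-- Both SIC relations read tr(G i G j) = (1 + dδ) / (d²(d + 1)), with δ the Kronecker delta of i
and j; the rest is bilinearity. -/
theorem IsSIC.trace_sum_comp_sum (hd : 2 ≤ finrank ℂ H) (hG : IsSIC G) (B C : Finset Ω) :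
    LinearMap.trace ℂ H ((∑ i ∈ B, G i) ∘ₗ ∑ j ∈ C, G j) =
      (B.card * C.card + finrank ℂ H * (B ∩ C).card) /
        ((finrank ℂ H : ℂ) ^ 2 * (1 + (finrank ℂ H : ℂ))) := by
  have hd0 : (finrank ℂ H : ℂ) ≠ 0 := Nat.cast_ne_zero.2 (by omega)
  have hd1 : (1 + finrank ℂ H : ℂ) ≠ 0 := by
    rw [← Nat.cast_one, ← Nat.cast_add]
    exact Nat.cast_ne_zero.2 (by omega)
  have key : ∀ i j, LinearMap.trace ℂ H (G i ∘ₗ G j) =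
      (1 + finrank ℂ H * if i = j then 1 else 0) /
        ((finrank ℂ H : ℂ) ^ 2 * (1 + (finrank ℂ H : ℂ))) := by
    intro i j
    split_ifs with hij
    · subst hij
      rw [hG.trace_sq]
      field_simp
    · rw [hG.trace_mul i j hij, mul_zero, add_zero]
  have hcomp : (∑ i ∈ B, G i) ∘ₗ ∑ j ∈ C, G j = ∑ i ∈ B, ∑ j ∈ C, G i ∘ₗ G j :=
    Finset.sum_mul_sum B C G G
  rw [hcomp]
  simp only [map_sum, key, ← Finset.sum_div, Finset.sum_add_distrib, ← Finset.mul_sum]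
  congr 1
  simp [Finset.sum_ite_eq, Finset.card_inter]

theorem IsSIC.trace_sum_comp_sum_eq_iff (hd : 2 ≤ finrank ℂ H) (hG : IsSIC G) (B C : Finset Ω) :
    LinearMap.trace ℂ H ((∑ i ∈ B, G i) ∘ₗ ∑ j ∈ C, G j) = 1 / (finrank ℂ H : ℂ) ↔
      B.card * C.card + finrank ℂ H * (B ∩ C).card = finrank ℂ H * (finrank ℂ H + 1) := by
  have hd0 : (finrank ℂ H : ℂ) ≠ 0 := Nat.cast_ne_zero.2 (by omega)
  have hd1 : (1 + finrank ℂ H : ℂ) ≠ 0 := by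
    rw [← Nat.cast_one, ← Nat.cast_add]
    exact Nat.cast_ne_zero.2 (by omega)
  rw [hG.trace_sum_comp_sum hd, ← Nat.cast_inj (R := ℂ), div_eq_div_iff (by positivity) hd0]
  push_cast
  constructor
  · intro h
    refine mul_right_cancel₀ hd0 (h.trans ?_)
    ring
  · intro h
    rw [h]
    ring

theorem IsSIC.unbiased_marginal_iff (hd : 2 ≤ finrank ℂ H) (hG : IsSIC G)
    {J : Type*} (P : J → Finpartition (Finset.univ : Finset Ω)) :
    Unbiased (fun j => marginal G (P j)) ↔
      ∀ i j, i ≠ j → OrthogonalPartitions (finrank ℂ H) (P i) (P j) := by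
  refine forall₃_congr fun i j _ => ?_
  constructor
  · exact fun h B hB C hC => (hG.trace_sum_comp_sum_eq_iff hd B C).1 (h ⟨B, hB⟩ ⟨C, hC⟩)
  · exact fun h B C => (hG.trace_sum_comp_sum_eq_iff hd B.1 C.1).2 (h B.1 B.2 C.1 C.2)

/-- At least three mutually unbiased marginals of a SIC in dimension `d` have `d` outcomes each and
form a net. -/
theorem IsSIC.exists_isNet (hd : 2 ≤ finrank ℂ H) (hG : IsSIC G)
    {S : Finset (Finpartition (Finset.univ : Finset Ω))} (hS : 3 ≤ S.card)
    (hU : Unbiased fun P : S => marginal G P.1) :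
    ∃ f : S → Ω → Fin (finrank ℂ H), IsNet f := by
  have hd0 : 0 < finrank ℂ H := by omega
  rw [hG.unbiased_marginal_iff hd] at hU
  refine exists_isNet_of_orthogonalPartitions hd0 hG.card_outcomes _ (fun P => ?_) hU
  obtain ⟨Q, R, hPQ, hPR, hQR⟩ : ∃ Q R : S, P ≠ Q ∧ P ≠ R ∧ Q ≠ R := by
    have : 1 < (Finset.univ.erase P).card := by
      rw [Finset.card_erase_of_mem (Finset.mem_univ P), Finset.card_univ, Fintype.card_coe]
      omega
    obtain ⟨Q, hQ, R, hR, hQR⟩ := Finset.one_lt_card.1 this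
    exact ⟨Q, R, (Finset.ne_of_mem_erase hQ).symm, (Finset.ne_of_mem_erase hR).symm, hQR⟩
  exact (hU P Q hPQ).card_parts hd0 hG.card_outcomes (hU P R hPR) (hU Q R hQR)

/-- Any bijection of Ω with (ℤ/d)² transports the net x, y, x + y; no further structure of the SIC
is needed. -/
theorem IsSIC.exists_three_mutuallyUnbiased (hd : 2 ≤ finrank ℂ H) (hG : IsSIC G) :
    ∃ S : Finset (Finpartition (Finset.univ : Finset Ω)),
      3 ≤ S.card ∧ MutuallyUnbiased (fun P : S => marginal G P.1) := by
  classical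
  have : NeZero (finrank ℂ H) := ⟨by omega⟩
  have hd0 : 0 < finrank ℂ H := by omega
  let e : Ω ≃ ZMod (finrank ℂ H) × ZMod (finrank ℂ H) :=
    Fintype.equivOfCardEq (by simp [hG.card_outcomes, sq])
  have hnet := (isNet_fst_snd_add (ZMod (finrank ℂ H))).comp_bijective e.bijective
  set P : Fin 3 → Finpartition (Finset.univ : Finset Ω) := fun i =>
    fiberPartition (![Prod.fst, Prod.snd, fun x => x.1 + x.2] i ∘ e)
  have hP : ∀ i j, i ≠ j → OrthogonalPartitions (finrank ℂ H) (P i) (P j) := fun i j hij => by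
    simpa using hnet.orthogonalPartitions hij
  have hcard : ∀ i, (P i).parts.card = finrank ℂ H := by
    intro i
    obtain ⟨j, k, hij, hik, hjk⟩ : ∃ j k : Fin 3, i ≠ j ∧ i ≠ k ∧ j ≠ k := by
      revert i
      decide
    exact (hP i j hij).card_parts hd0 hG.card_outcomes (hP i k hik) (hP j k hjk)
  -- A partition orthogonal to itself would have bins of size |B ∩ B| = 1, but the bins have size d
  -- ≥ 2.
  have hinj : Function.Injective P := by
    intro i j he
    by_contra hij
    have horth := hP i j hij
    rw [← he] at horth
    obtain ⟨B, hB⟩ := Finset.card_pos.1 (by rw [hcard i]; omega : 0 < (P i).parts.card)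
    have h1 := horth.card_inter hd0 hG.card_outcomes hB hB
    rw [Finset.inter_self, horth.card_eq hd0 hG.card_outcomes hB, hcard] at h1
    omega
  have hmem : ∀ Q ∈ Finset.univ.image P, ∃ i, P i = Q := fun Q hQ => by simpa using hQ
  refine ⟨Finset.univ.image P, by simp [Finset.card_image_of_injective _ hinj],
    fun Q => hG.isPOVM.marginal Q.1, fun Q => ?_, ?_⟩
  · obtain ⟨i, hi⟩ := hmem Q.1 Q.2
    rw [Fintype.card_coe, ← hi, hcard]
  · rw [hG.unbiased_marginal_iff hd]
    intro Q R hQR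
    obtain ⟨i, hi⟩ := hmem Q.1 Q.2
    obtain ⟨j, hj⟩ := hmem R.1 R.2
    rw [← hi, ← hj]
    refine hP i j ?_
    rintro rfl
    exact hQR (Subtype.ext (hi.symm.trans hj))

end SIC

theorem mainTheorem3 {H : Type*} [NormedAddCommGroup H] [InnerProductSpace ℂ H]
    [FiniteDimensional ℂ H] (hd : 2 ≤ finrank ℂ H)
    {Ω : Type*} [Fintype Ω] [DecidableEq Ω] (G : Ω → H →ₗ[ℂ] H) (hG : IsSIC G) :
    (∃ S : Finset (Finpartition (Finset.univ : Finset Ω)),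
      3 ≤ S.card ∧ MutuallyUnbiased (fun P : S => marginal G P.1)) ∧
    (∀ S : Finset (Finpartition (Finset.univ : Finset Ω)),
      Unbiased (fun P : S => marginal G P.1) → S.card ≤ finrank ℂ H + 1) ∧
    (finrank ℂ H = 6 → ∀ S : Finset (Finpartition (Finset.univ : Finset Ω)),
      Unbiased (fun P : S => marginal G P.1) → S.card ≤ 3) := by
  refine ⟨hG.exists_three_mutuallyUnbiased hd, fun S hU => ?_, fun h6 S hU => ?_⟩
  -- Fewer than three marginals need not form a net, but then the bound is trivial.
  · by_cases hS : S.card < 3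
    · omega
    · obtain ⟨f, hf⟩ := hG.exists_isNet hd (by omega) hU
      have : Nontrivial S := Fintype.one_lt_card_iff_nontrivial.1 (by rw [Fintype.card_coe]; omega)
      simpa using hf.card_le (by simpa using hd)
  · by_contra! hS
    obtain ⟨f, hf⟩ := hG.exists_isNet hd (by omega) hU
    obtain ⟨g⟩ : Nonempty (Fin 4 ↪ S) := Function.Embedding.nonempty_of_card_le
      (by rw [Fintype.card_fin, Fintype.card_coe]; exact hS)
    exact not_isNet_of_card_eq_six (by simpa using h6) (fun i => f (g i))
      fun i j hij => hf _ _ (g.injective.ne hij)
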